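/- **Theorem 7.2 (LC-equivalence diameter bound).** For a simple graph $G$ on the vertex set $[n]=\{1,\dots,n\}$, let $|G\rangle=\prod_{ij\in E(G)}CZ_{ij}\,|+\rangle^{\otimes n}$ be its graph state. Two $n$-qubit states $|\psi\rangle,|\varphi\rangle$ are LC-equivalent if, up to a global phase, $|\psi\rangle=(U_1\otimes\cdots\otimes U_n)|\varphi\rangle$ for some one-qubit Clifford gates $U_1,\dots,U_n$ (products of the Hadamard gate and the phase gate $\mathrm{diag}(1,i)$). The vertex complementation of $G$ at a vertex $i$ is the graph $\tau_i(G)$ obtained from $G$ by exchanging edges and non-edges between distinct vertices of the neighborhood $N(i)$. Vertices are unlabeled, i.e. isomorphic graphs are identified: the orbit of $|G\rangle$ is the set of all isomorphism classes that contain a graph $H$ with $|H\rangle$ LC-equivalent to $|G\rangle$. The distance of two members $c,d$ of the orbit is the smallest number of vertex complementations needed to transform $c$ into $d$ inside the orbit, where one vertex complementation takes the isomorphism class of a graph $H$ to the class of $\tau_i(H)$ for a vertex $i$ of $H$ (the distance is $\infty$ if this is impossible). The diameter of the orbit is the supremum of these distances. Then for every $n$ and every graph $G$ on $[n]$, the orbit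 of $|G\rangle$ has diameter at most $\lfloor 3n/2\rfloor$. -/

import Mathlib

open scoped Matrix symmDiff

noncomputable section

namespace GraphState

/-- Amplitude vectors of `n` qubits in the computational basis `{0,1}ⁿ`. -/
abbrev QState (n : ℕ) : Type := (Fin n → Fin 2) → ℂ

/-- The Hadamard gate. -/
def hadamard : Matrix (Fin 2) (Fin 2) ℂ :=
  ((Real.sqrt 2 : ℝ) : ℂ)⁻¹ • !![1, 1; 1, -1]

/-- The phase gate `R_z(π/2) = diag(1, i)`. -/
def phaseGate : Matrix (Fin 2) (Fin 2) ℂ :=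
  !![1, 0; 0, Complex.I]

/-- The one-qubit Clifford gates: all products of the two one-qubit generators of Clifford circuits.
Both generators have finite order, so these products form a group. Global phases are
accounted for in `LCEquiv`. -/
def clifford : Submonoid (Matrix (Fin 2) (Fin 2) ℂ) :=
  Submonoid.closure {hadamard, phaseGate}

/-- The tensor product `U₁ ⊗ ⋯ ⊗ Uₙ` of one-qubit operators. -/
def tensor {n : ℕ} (U : Fin n → Matrix (Fin 2) (Fin 2) ℂ) :
    Matrix (Fin n → Fin 2) (Fin n → Fin 2) ℂ :=
  Matrix.of fun x y => ∏ i, U i (x i) (y i)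

/-- Local Clifford equivalence of states; states are identified up to a phase factor. -/
def LCEquiv {n : ℕ} (ψ φ : QState n) : Prop :=
  ∃ U : Fin n → Matrix (Fin 2) (Fin 2) ℂ, (∀ i, U i ∈ clifford) ∧
    ∃ α : ℂ, ‖α‖ = 1 ∧ ψ = α • (tensor U *ᵥ φ)

open Classical in
/-- The controlled-Z gate on the two qubits that form the unordered pair `e`: it multiplies a
basis state by `-1` if both qubits are `1` and fixes it otherwise. -/
def controlledZ {n : ℕ} (e : Sym2 (Fin n)) : Matrix (Fin n → Fin 2) (Fin n → Fin 2) ℂ :=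
  Matrix.diagonal fun x => if ∀ i ∈ e, x i = 1 then -1 else 1

theorem controlledZ_commute {n : ℕ} (s : Set (Sym2 (Fin n))) :
    s.Pairwise (Function.onFun Commute (controlledZ (n := n))) :=
  fun _ _ _ _ _ => Matrix.commute_diagonal _ _

/-- The state `|+⟩ ⊗ ⋯ ⊗ |+⟩`. -/
def plusState (n : ℕ) : QState n := fun _ => (((Real.sqrt 2 : ℝ) : ℂ)⁻¹) ^ n

open Classical in
/-- The graph state `|G⟩ = ∏_{ij ∈ E} CZ_{ij} |+⟩^{⊗ n}`. -/
def graphState {n : ℕ} (G : SimpleGraph (Fin n)) : QState n :=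
  (G.edgeFinset.noncommProd controlledZ (controlledZ_commute _)) *ᵥ plusState n

/-- The graph whose edges are all pairs of distinct vertices of `A`. -/
def cliqueOn {V : Type*} (A : Set V) : SimpleGraph V where
  Adj u v := u ≠ v ∧ u ∈ A ∧ v ∈ A
  symm := ⟨fun _ _ h => ⟨h.1.symm, h.2.2, h.2.1⟩⟩
  loopless := ⟨fun _ h => h.1 rfl⟩

/-- Vertex complementation (local complementation) of `G` at `i`: the edge set becomes
`E ∆ K(N(i))`. -/
def vertexCompl {V : Type*} (G : SimpleGraph V) (i : V) : SimpleGraph V :=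
  G ∆ cliqueOn (G.neighborSet i)

theorem neighborSet_vertexCompl {V : Type*} (G : SimpleGraph V) (i : V) :
    (vertexCompl G i).neighborSet i = G.neighborSet i := by
  ext v
  simp [vertexCompl, symmDiff_def, cliqueOn]

theorem vertexCompl_vertexCompl {V : Type*} (G : SimpleGraph V) (i : V) :
    vertexCompl (vertexCompl G i) i = G := by
  conv_lhs => rw [vertexCompl, neighborSet_vertexCompl, vertexCompl]
  exact symmDiff_symmDiff_cancel_right _ _

/-- Graph isomorphism. -/
def isoSetoid (n : ℕ) : Setoid (SimpleGraph (Fin n)) where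
  r G H := Nonempty (G ≃g H)
  iseqv := ⟨fun _ => ⟨RelIso.refl _⟩, fun ⟨e⟩ => ⟨e.symm⟩, fun ⟨e⟩ ⟨f⟩ => ⟨e.trans f⟩⟩

/-- Graphs with `n` unlabeled vertices: isomorphism classes of graphs on `[n]`. -/
abbrev UnlabeledGraph (n : ℕ) : Type := Quotient (isoSetoid n)

/-- The isomorphism class of a graph. -/
def unlabel {n : ℕ} (G : SimpleGraph (Fin n)) : UnlabeledGraph n := Quotient.mk (isoSetoid n) G

/-- The orbit of the graph state `|G⟩` with unlabeled vertices: all isomorphism classes of graphs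
that contain a graph `H` such that `|H⟩` is LC-equivalent to `|G⟩`. -/
def lcOrbit {n : ℕ} (G : SimpleGraph (Fin n)) : Set (UnlabeledGraph n) :=
  {c | ∃ H : SimpleGraph (Fin n), unlabel H = c ∧ LCEquiv (graphState G) (graphState H)}

/-- Two distinct unlabeled graphs are adjacent if one vertex complementation transforms one
into the other. -/
def complGraph (n : ℕ) : SimpleGraph (UnlabeledGraph n) where
  Adj c d := c ≠ d ∧ ∃ (G : SimpleGraph (Fin n)) (i : Fin n),
    unlabel G = c ∧ unlabel (vertexCompl G i) = d
  symm := ⟨by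
    rintro c d ⟨hne, G, i, hc, hd⟩
    exact ⟨hne.symm, vertexCompl G i, i, hd, by rw [vertexCompl_vertexCompl, hc]⟩⟩
  loopless := ⟨fun _ h => h.1 rfl⟩

/-- The orbit of `|G⟩` as a graph, an edge being one vertex complementation. Its distance is the
smallest number of vertex complementations that transform one member into another (`⊤` if there
is none). -/
def orbitGraph {n : ℕ} (G : SimpleGraph (Fin n)) : SimpleGraph (lcOrbit G) :=
  (complGraph n).induce (lcOrbit G)

end GraphState

end

/-!
If `|G⟩ = α (U₁ ⊗ ⋯ ⊗ Uₙ) |H⟩` with one-qubit Clifford gates `U k`, then each `U k` conjugates `Z` to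
plus or minus a Pauli matrix, whose axis is denoted `t k`. Only these axes matter: if all of them
are `Z`, then `G = H` (`AlignedBy.eq`). Call a qubit tilted if its axis is not `Z`. A vertex
complementation of `G` at `i` is a local Clifford operator, which exchanges the axes `Y` and `Z`
at `i`, exchanges `X` and `Y` at the neighbors of `i`, and does nothing elsewhere
(`tensor_complOp_mulVec`, `AlignedBy.complement`); so it can change whether a qubit is tilted only
at `i` itself.

A tilted qubit with axis `Y` is thus straightened by one complementation. If all tilted qubits have
the axis `X`, then each of them has a tilted neighbor (`AlignedBy.exists_adj`), and the three
complementations at `i`, `j`, `i` along such an edge `ij` straighten both ends. Hence `3 / 2`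
complementations per tilted qubit lead from `G` to `H` (`AlignedBy.exists_list`), and they stay in
the orbit because vertex complementations are local Clifford operators. The number of tilted qubits
is at most `n`.

The two facts about `G` and `H` that this uses both come from the stabilizer generator
`X_i Z_{N(i)}` of `|G⟩`. If the neighbors of `i` have the axis `Z`, then the pullback of this
generator along the aligning operator is diagonal with entries `±1` away from `i`, and it
stabilizes `|H⟩` (`AlignedBy.exists_stabilizer`). If `i` has the axis `X`, this is a contradiction;
if `i` has the axis `Z`, it shows that `i` has the same neighbors in `G` and `H`.
-/

noncomputable section

namespace GraphState

/-! ### Amplitudes of graph states -/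

open Classical in
/-- The sign `∏_{k ∈ N(i)} (-1)^{x k}`: the diagonal of the operator `Z_{N(i)}`. -/
def nbrSign {n : ℕ} (G : SimpleGraph (Fin n)) (i : Fin n) (x : Fin n → Fin 2) : ℂ :=
  ∏ k, if G.Adj i k ∧ x k = 1 then -1 else 1

open Classical in
/-- The sign of the amplitude of `|G⟩` at `x`: minus one to the number of edges of `G` inside the
support of `x`. -/
def edgeSign {n : ℕ} (G : SimpleGraph (Fin n)) (x : Fin n → Fin 2) : ℂ :=
  ∏ e : Sym2 (Fin n), if e ∈ G.edgeSet ∧ ∀ i ∈ e, x i = 1 then -1 else 1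

theorem graphState_apply {n : ℕ} (G : SimpleGraph (Fin n)) (x : Fin n → Fin 2) :
    graphState G x = edgeSign G x * (((Real.sqrt 2 : ℝ) : ℂ)⁻¹) ^ n := by
  classical
  have key : ∀ (s : Finset (Sym2 (Fin n))) (h : _),
      s.noncommProd controlledZ h =
        Matrix.diagonal fun x => ∏ e ∈ s, if ∀ i ∈ e, x i = 1 then (-1 : ℂ) else 1 := by
    intro s
    induction s using Finset.induction_on with
    | empty => intro h; simp
    | insert a s ha ih =>
      intro h
      rw [Finset.noncommProd_insert_of_notMem _ _ _ _ ha, ih, controlledZ,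
        Matrix.diagonal_mul_diagonal]
      congr 1
      funext x
      rw [Finset.prod_insert ha]
  rw [graphState, key, Matrix.mulVec_diagonal, plusState]
  congr 1
  rw [show G.edgeFinset = Finset.univ.filter (· ∈ G.edgeSet) by ext; simp, Finset.prod_filter]
  refine Finset.prod_congr rfl fun e _ => ?_
  by_cases he : e ∈ G.edgeSet
  · simp only [he, if_true, true_and]
  · simp [he]

theorem edgeSign_mul_self {n : ℕ} (G : SimpleGraph (Fin n)) (x : Fin n → Fin 2) :
    edgeSign G x * edgeSign G x = 1 := by
  rw [edgeSign, ← Finset.prod_mul_distrib]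
  exact Finset.prod_eq_one fun e _ => by split_ifs <;> norm_num

theorem nbrSign_mul_self {n : ℕ} (G : SimpleGraph (Fin n)) (i : Fin n) (x : Fin n → Fin 2) :
    nbrSign G i x * nbrSign G i x = 1 := by
  rw [nbrSign, ← Finset.prod_mul_distrib]
  exact Finset.prod_eq_one fun e _ => by split_ifs <;> norm_num

theorem graphState_ne_zero {n : ℕ} (G : SimpleGraph (Fin n)) (x : Fin n → Fin 2) :
    graphState G x ≠ 0 := by
  rw [graphState_apply]
  refine mul_ne_zero (left_ne_zero_of_mul_eq_one (edgeSign_mul_self G x)) ?_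
  simp

theorem nbrSign_update {n : ℕ} (G : SimpleGraph (Fin n)) (i : Fin n) (x : Fin n → Fin 2)
    (b : Fin 2) : nbrSign G i (Function.update x i b) = nbrSign G i x := by
  refine Finset.prod_congr rfl fun k _ => ?_
  by_cases hk : k = i
  · subst hk; simp
  · rw [Function.update_of_ne hk]

/-- Switching on the vertex `i` adds the edges from `i` to the vertices that are on. -/
theorem edgeSign_update_one {n : ℕ} (G : SimpleGraph (Fin n)) (i : Fin n) (x : Fin n → Fin 2) :
    edgeSign G (Function.update x i 1) = nbrSign G i x * edgeSign G (Function.update x i 0) := by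
  classical
  have hinj : Function.Injective fun k : Fin n => s(i, k) := fun a b h => Sym2.congr_right.1 h
  -- Reindex the neighbors `k` of `i` by the edges `s(i, k)`.
  have h1 : nbrSign G i x = ∏ e : Sym2 (Fin n),
      if e ∈ G.edgeSet ∧ i ∈ e ∧ ∀ k ∈ e, k ≠ i → x k = 1 then (-1 : ℂ) else 1 := by
    rw [nbrSign]
    refine Finset.prod_of_injOn (fun k => s(i, k)) hinj.injOn (fun _ _ => Finset.mem_univ _) ?_ ?_
    · intro e _ he
      rw [if_neg]
      rintro ⟨_, hi, _⟩
      obtain ⟨k, rfl⟩ := hi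
      exact he ⟨k, by simp⟩
    · intro k _
      refine if_congr ?_ rfl rfl
      simp only [SimpleGraph.mem_edgeSet, Sym2.mem_iff]
      constructor
      · rintro ⟨h, hx⟩
        exact ⟨h, by simp, by rintro l (rfl | rfl) hl; exacts [absurd rfl hl, hx]⟩
      · rintro ⟨h, -, hx⟩
        exact ⟨h, hx k (Or.inr rfl) h.ne'⟩
  rw [h1, edgeSign, edgeSign, ← Finset.prod_mul_distrib]
  refine Finset.prod_congr rfl fun e _ => ?_
  by_cases he : e ∈ G.edgeSet
  · by_cases hi : i ∈ e
    · have h0 : ¬ ∀ k ∈ e, Function.update x i 0 k = 1 := fun h => by simpa using h i hi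
      have h2 : (∀ k ∈ e, Function.update x i 1 k = 1) ↔ ∀ k ∈ e, k ≠ i → x k = 1 := by
        refine forall₂_congr fun k _ => ?_
        by_cases hk : k = i
        · subst hk; simp
        · simp [hk]
      simp only [he, hi, h0, h2, true_and, if_false, mul_one]
    · have h2 : ∀ b : Fin 2, (∀ k ∈ e, Function.update x i b k = 1) ↔ ∀ k ∈ e, x k = 1 := by
        refine fun b => forall₂_congr fun k hk => ?_
        rw [Function.update_of_ne (ne_of_mem_of_not_mem hk hi)]
      simp only [he, hi, h2, true_and, false_and, if_false, one_mul]
  · simp [he]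

theorem graphState_update_one {n : ℕ} (G : SimpleGraph (Fin n)) (i : Fin n) (x : Fin n → Fin 2) :
    graphState G (Function.update x i 1) =
      nbrSign G i x * graphState G (Function.update x i 0) := by
  rw [graphState_apply, graphState_apply, edgeSign_update_one, mul_assoc]

/-- Flipping the bit `i` multiplies the amplitude by the sign of `Z_{N(i)}`. This is the stabilizer
equation of `X_i Z_{N(i)}` in terms of amplitudes. -/
theorem graphState_update_rev {n : ℕ} (G : SimpleGraph (Fin n)) (i : Fin n) (x : Fin n → Fin 2) :
    graphState G (Function.update x i (x i).rev) = nbrSign G i x * graphState G x := by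
  have h := graphState_update_one G i x
  have hx := Function.update_eq_self i x
  obtain hb | hb : x i = 0 ∨ x i = 1 := by generalize x i = b; fin_cases b <;> simp
  · rw [hb] at hx ⊢
    rw [hx] at h
    exact h
  · rw [hb] at hx ⊢
    rw [hx] at h
    rw [h, ← mul_assoc, nbrSign_mul_self, one_mul]
    rfl

theorem edgeSign_symmDiff {n : ℕ} (G K : SimpleGraph (Fin n)) (x : Fin n → Fin 2) :
    edgeSign (G ∆ K) x = edgeSign G x * edgeSign K x := by
  classical
  rw [edgeSign, edgeSign, edgeSign, ← Finset.prod_mul_distrib]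
  refine Finset.prod_congr rfl fun e _ => ?_
  have : e ∈ (G ∆ K).edgeSet ↔ (e ∈ G.edgeSet ∧ e ∉ K.edgeSet ∨ e ∈ K.edgeSet ∧ e ∉ G.edgeSet) := by
    induction e with | h a b => simp [symmDiff_def]
  by_cases h1 : e ∈ G.edgeSet <;> by_cases h2 : e ∈ K.edgeSet <;>
    simp only [this, h1, h2, true_and, false_and, not_true, not_false_iff, or_false, false_or,
      if_false] <;> (try split_ifs) <;> norm_num

open Classical in
/-- The sign of a clique with `m` vertices in the support of `x`, `(-1)^(m choose 2)`, is the
product of `(-i)^m` with `1` or `i`, according to the parity of `m`. -/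
theorem edgeSign_cliqueOn {n : ℕ} (A : Set (Fin n)) (x : Fin n → Fin 2) :
    edgeSign (cliqueOn A) x = (∏ k, if k ∈ A ∧ x k = 1 then -Complex.I else 1) *
      ((1 + Complex.I) / 2 + (1 - Complex.I) / 2 * ∏ k, if k ∈ A ∧ x k = 1 then (-1 : ℂ) else 1) := by
  have hI := Complex.I_mul_I
  -- Switch the vertices of the support on one at a time.
  suffices H : ∀ s : Finset (Fin n), ∀ x : Fin n → Fin 2, (∀ k, x k = 1 ↔ k ∈ s) →
      edgeSign (cliqueOn A) x = (∏ k, if k ∈ A ∧ x k = 1 then -Complex.I else 1) *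
        ((1 + Complex.I) / 2 +
          (1 - Complex.I) / 2 * ∏ k, if k ∈ A ∧ x k = 1 then (-1 : ℂ) else 1) from
    H (Finset.univ.filter fun k => x k = 1) x fun k => by simp
  intro s
  induction s using Finset.induction_on with
  | empty =>
    intro x hx
    have hx' : ∀ k, x k ≠ 1 := by simpa using hx
    have : edgeSign (cliqueOn A) x = 1 := by
      refine Finset.prod_eq_one fun e _ => if_neg ?_
      rintro ⟨-, h⟩
      induction e with | h a b => exact hx' a (h a (by simp))
    simp [this, hx']
    ring
  | insert i s hi ih =>
    intro x hx
    obtain ⟨y, hy0, rfl⟩ : ∃ y : Fin n → Fin 2, y i = 0 ∧ x = Function.update y i 1 :=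
      ⟨Function.update x i 0, by simp, by
        have := (hx i).2 (by simp)
        simp [← this]⟩
    have hys : ∀ k, y k = 1 ↔ k ∈ s := by
      intro k
      by_cases hk : k = i
      · subst hk; simp [hy0, hi]
      · simpa [Function.update_of_ne hk, hk] using hx k
    have hprod : ∀ c : ℂ, (∏ k, if k ∈ A ∧ Function.update y i 1 k = 1 then c else 1) =
        (if i ∈ A then c else 1) * ∏ k, if k ∈ A ∧ y k = 1 then c else 1 := by
      intro c
      rw [← Finset.mul_prod_erase _ _ (Finset.mem_univ i),
        ← Finset.mul_prod_erase Finset.univ (fun k => if k ∈ A ∧ y k = 1 then c else 1)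
          (Finset.mem_univ i)]
      have : ∏ k ∈ Finset.univ.erase i, (if k ∈ A ∧ Function.update y i 1 k = 1 then c else 1) =
          ∏ k ∈ Finset.univ.erase i, if k ∈ A ∧ y k = 1 then c else 1 :=
        Finset.prod_congr rfl fun k hk => by
          rw [Function.update_of_ne (Finset.ne_of_mem_erase hk)]
      rw [this]
      simp [hy0]
    have hnbr : nbrSign (cliqueOn A) i y =
        if i ∈ A then ∏ k, (if k ∈ A ∧ y k = 1 then (-1 : ℂ) else 1) else 1 := by
      split_ifs with hA
      · refine Finset.prod_congr rfl fun k _ => if_congr ?_ rfl rfl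
        by_cases hk : k = i
        · subst hk; simp [hy0]
        · simp [cliqueOn, hA, Ne.symm hk]
      · exact Finset.prod_eq_one fun k _ => by simp [cliqueOn, hA]
    have hsq : (∏ k, (if k ∈ A ∧ y k = 1 then (-1 : ℂ) else 1)) *
        (∏ k, (if k ∈ A ∧ y k = 1 then (-1 : ℂ) else 1)) = 1 := by
      rw [← Finset.prod_mul_distrib]
      exact Finset.prod_eq_one fun e _ => by split_ifs <;> norm_num
    rw [edgeSign_update_one, hnbr, hprod, hprod,
      show Function.update y i 0 = y by rw [← hy0, Function.update_eq_self], ih y hys]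
    split_ifs with hA
    · linear_combination (∏ k, if k ∈ A ∧ y k = 1 then -Complex.I else 1) *
        ((1 - Complex.I) / 2 * hsq + (1 + (∏ k, if k ∈ A ∧ y k = 1 then (-1 : ℂ) else 1)) / 2 * hI)
    · ring

open Classical in
theorem graphState_vertexCompl {n : ℕ} (G : SimpleGraph (Fin n)) (i : Fin n)
    (x : Fin n → Fin 2) :
    graphState (vertexCompl G i) x =
      (∏ k, if G.Adj i k ∧ x k = 1 then -Complex.I else 1) *
        ((1 + Complex.I) / 2 + (1 - Complex.I) / 2 * nbrSign G i x) * graphState G x := by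
  rw [graphState_apply, graphState_apply, vertexCompl, edgeSign_symmDiff, edgeSign_cliqueOn]
  simp only [SimpleGraph.mem_neighborSet, nbrSign]
  ring

/-! ### Local Clifford operators -/

theorem tensor_mul {n : ℕ} (U V : Fin n → Matrix (Fin 2) (Fin 2) ℂ) :
    tensor U * tensor V = tensor fun i => U i * V i := by
  ext x y
  simp only [tensor, Matrix.mul_apply, Matrix.of_apply, ← Finset.prod_mul_distrib]
  rw [Finset.prod_univ_sum, Fintype.piFinset_univ]

theorem tensor_one {n : ℕ} : tensor (fun _ : Fin n => (1 : Matrix (Fin 2) (Fin 2) ℂ)) = 1 := by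
  ext x y
  by_cases h : x = y
  · subst h; simp [tensor]
  · obtain ⟨i, hi⟩ := Function.ne_iff.1 h
    rw [Matrix.one_apply_ne h]
    exact Finset.prod_eq_zero (Finset.mem_univ i) (Matrix.one_apply_ne hi)

/-- A local operator that is diagonal away from the qubit `i` mixes only the amplitudes at `x` and
at `x` with the bit `i` flipped. -/
theorem tensor_mulVec_apply {n : ℕ} (U : Fin n → Matrix (Fin 2) (Fin 2) ℂ) (i : Fin n)
    (hU : ∀ k, k ≠ i → (U k).IsDiag) (ψ : QState n) (x : Fin n → Fin 2) :
    (tensor U *ᵥ ψ) x = (∏ k ∈ Finset.univ.erase i, U k (x k) (x k)) *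
      (U i (x i) (x i) * ψ x + U i (x i) (x i).rev * ψ (Function.update x i (x i).rev)) := by
  have hne : (x i).rev ≠ x i := by generalize x i = b; fin_cases b <;> decide
  have huniv : ∀ b : Fin 2, b ≠ x i → b = (x i).rev := by generalize x i = b; fin_cases b <;> decide
  have hxne : Function.update x i (x i).rev ≠ x := fun h => hne (by simpa using congrFun h i)
  rw [Matrix.mulVec, dotProduct, Fintype.sum_eq_add x (Function.update x i (x i).rev) hxne.symm]
  · simp only [tensor, Matrix.of_apply]
    rw [← Finset.mul_prod_erase _ _ (Finset.mem_univ i),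
      ← Finset.mul_prod_erase Finset.univ
        (fun k => U k (x k) (Function.update x i (x i).rev k)) (Finset.mem_univ i),
      Finset.prod_congr (s₁ := Finset.univ.erase i) rfl
        (f := fun k => U k (x k) (Function.update x i (x i).rev k))
        fun k hk => by rw [Function.update_of_ne (Finset.ne_of_mem_erase hk)]]
    simp only [Function.update_self]
    ring
  · rintro y ⟨h1, h2⟩
    obtain ⟨k, hki, hk⟩ : ∃ k, k ≠ i ∧ x k ≠ y k := by
      by_contra! h
      by_cases hi : y i = x i
      · exact h1 (funext fun k => if hk : k = i then hk ▸ hi else (h k hk).symm)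
      · refine h2 (funext fun k => ?_)
        by_cases hk : k = i
        · subst hk; simpa using huniv _ hi
        · simpa [Function.update_of_ne hk] using (h k hk).symm
    rw [tensor, Matrix.of_apply, Finset.prod_eq_zero (Finset.mem_univ k) (hU k hki hk), zero_mul]

/-- The three axes of the Bloch sphere, one for each Pauli matrix. -/
inductive Axis
  | x | y | z
  deriving DecidableEq

/-- The Pauli matrix of an axis. -/
def pauli : Axis → Matrix (Fin 2) (Fin 2) ℂ
  | .x => !![0, 1; 1, 0]
  | .y => !![0, -Complex.I; Complex.I, 0]
  | .z => !![1, 0; 0, -1]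

/-- `U` conjugates the Pauli matrix of the axis `a` to plus or minus that of the axis `b`. -/
def SendsPauli (U : Matrix (Fin 2) (Fin 2) ℂ) (a b : Axis) : Prop :=
  ∃ s : ℂ, s * s = 1 ∧ U * pauli a = s • (pauli b * U)

theorem SendsPauli.mul {U V : Matrix (Fin 2) (Fin 2) ℂ} {a b c : Axis} (hU : SendsPauli U b c)
    (hV : SendsPauli V a b) : SendsPauli (U * V) a c := by
  obtain ⟨s, hs, hU⟩ := hU
  obtain ⟨t, ht, hV⟩ := hV
  refine ⟨s * t, by linear_combination (t * t) * hs + ht, ?_⟩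
  rw [mul_assoc, hV, mul_smul_comm, ← mul_assoc, hU, smul_mul_assoc, smul_smul, mul_assoc, mul_comm]

/-- The action of the Hadamard gate on the axes. -/
def hadamardAxis : Axis → Axis
  | .x => .z
  | .y => .y
  | .z => .x

/-- The action of the phase gate on the axes. -/
def phaseAxis : Axis → Axis
  | .x => .y
  | .y => .x
  | .z => .z

theorem sendsPauli_hadamard (a : Axis) : SendsPauli hadamard a (hadamardAxis a) := by
  cases a
  · refine ⟨1, by norm_num, ?_⟩
    ext i j; fin_cases i <;> fin_cases j <;> simp [hadamard, pauli, hadamardAxis]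
  · refine ⟨-1, by norm_num, ?_⟩
    ext i j; fin_cases i <;> fin_cases j <;> simp [hadamard, pauli, hadamardAxis] <;> ring
  · refine ⟨1, by norm_num, ?_⟩
    ext i j; fin_cases i <;> fin_cases j <;> simp [hadamard, pauli, hadamardAxis]

theorem sendsPauli_phaseGate (a : Axis) : SendsPauli phaseGate a (phaseAxis a) := by
  cases a
  · refine ⟨1, by norm_num, ?_⟩
    ext i j; fin_cases i <;> fin_cases j <;> simp [phaseGate, pauli, phaseAxis]
  · refine ⟨-1, by norm_num, ?_⟩
    ext i j; fin_cases i <;> fin_cases j <;> simp [phaseGate, pauli, phaseAxis]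
  · refine ⟨1, by norm_num, ?_⟩
    ext i j; fin_cases i <;> fin_cases j <;> simp [phaseGate, pauli, phaseAxis]

theorem hadamard_mem : hadamard ∈ clifford := Submonoid.subset_closure (by simp)

theorem phaseGate_mem : phaseGate ∈ clifford := Submonoid.subset_closure (by simp)

theorem hadamard_mul_self : hadamard * hadamard = 1 := by
  have h : (((Real.sqrt 2 : ℝ) : ℂ)⁻¹) * (((Real.sqrt 2 : ℝ) : ℂ)⁻¹) = 1 / 2 := by
    rw [← mul_inv, ← Complex.ofReal_mul, Real.mul_self_sqrt (by norm_num)]; norm_num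
  rw [hadamard, smul_mul_smul_comm, h]
  ext i j; fin_cases i <;> fin_cases j <;> norm_num [Matrix.mul_apply, Fin.sum_univ_two]

theorem phaseGate_mul_pow_three : phaseGate * phaseGate ^ 3 = 1 := by
  rw [← pow_succ']
  ext i j; fin_cases i <;> fin_cases j <;>
    norm_num [phaseGate, pow_succ, Matrix.mul_apply, Fin.sum_univ_two]

theorem exists_inverse_of_mem_clifford {U : Matrix (Fin 2) (Fin 2) ℂ} (hU : U ∈ clifford) :
    ∃ V ∈ clifford, V * U = 1 := by
  induction hU using Submonoid.closure_induction with
  | mem U hU =>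
    obtain rfl | rfl : U = hadamard ∨ U = phaseGate := by simpa using hU
    · exact ⟨_, hadamard_mem, hadamard_mul_self⟩
    · refine ⟨_, pow_mem phaseGate_mem 3, ?_⟩
      rw [← pow_succ, pow_succ', phaseGate_mul_pow_three]
  | one => exact ⟨1, one_mem _, one_mul 1⟩
  | mul U V _ _ hU hV =>
    obtain ⟨U', hU', hU⟩ := hU
    obtain ⟨V', hV', hV⟩ := hV
    exact ⟨V' * U', mul_mem hV' hU', by rw [mul_assoc, ← mul_assoc U', hU, one_mul, hV]⟩

theorem exists_sendsPauli_of_mem_clifford {U : Matrix (Fin 2) (Fin 2) ℂ} (hU : U ∈ clifford)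
    (a : Axis) : ∃ b, SendsPauli U a b := by
  induction hU using Submonoid.closure_induction generalizing a with
  | mem U hU =>
    obtain rfl | rfl : U = hadamard ∨ U = phaseGate := by simpa using hU
    · exact ⟨_, sendsPauli_hadamard a⟩
    · exact ⟨_, sendsPauli_phaseGate a⟩
  | one => exact ⟨a, 1, by norm_num, by simp⟩
  | mul U V _ _ hU hV =>
    obtain ⟨b, hV⟩ := hV a
    obtain ⟨c, hU⟩ := hU b
    exact ⟨c, hU.mul hV⟩

theorem LCEquiv.trans {n : ℕ} {ψ φ χ : QState n} (h : LCEquiv ψ φ) (h' : LCEquiv φ χ) :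
    LCEquiv ψ χ := by
  obtain ⟨U, hU, α, hα, rfl⟩ := h
  obtain ⟨V, hV, β, hβ, rfl⟩ := h'
  refine ⟨fun i => U i * V i, fun i => mul_mem (hU i) (hV i), α * β, by simp [hα, hβ], ?_⟩
  rw [Matrix.mulVec_smul, Matrix.mulVec_mulVec, tensor_mul, smul_smul]

theorem LCEquiv.symm {n : ℕ} {ψ φ : QState n} (h : LCEquiv ψ φ) : LCEquiv φ ψ := by
  obtain ⟨U, hU, α, hα, rfl⟩ := h
  choose V hV hVU using fun i => exists_inverse_of_mem_clifford (hU i)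
  have hα0 : α ≠ 0 := by rintro rfl; simp at hα
  refine ⟨V, hV, α⁻¹, by simp [hα], ?_⟩
  rw [Matrix.mulVec_smul, Matrix.mulVec_mulVec, tensor_mul]
  simp only [hVU]
  rw [tensor_one, Matrix.one_mulVec, inv_smul_smul₀ hα0]

open Classical in
/-- The local Clifford operator of a vertex complementation at `i`: a square root of `X` at `i`
and a square root of `Z` at each neighbor of `i`. -/
def complOp {n : ℕ} (G : SimpleGraph (Fin n)) (i k : Fin n) : Matrix (Fin 2) (Fin 2) ℂ :=
  if k = i then hadamard * phaseGate * hadamard else if G.Adj i k then phaseGate ^ 3 else 1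

theorem complOp_mem {n : ℕ} (G : SimpleGraph (Fin n)) (i k : Fin n) : complOp G i k ∈ clifford := by
  unfold complOp
  split_ifs
  · exact mul_mem (mul_mem hadamard_mem phaseGate_mem) hadamard_mem
  · exact pow_mem phaseGate_mem 3
  · exact one_mem _

theorem sqrtX_eq : hadamard * phaseGate * hadamard =
    !![(1 + Complex.I) / 2, (1 - Complex.I) / 2; (1 - Complex.I) / 2, (1 + Complex.I) / 2] := by
  have h : (((Real.sqrt 2 : ℝ) : ℂ)⁻¹) * (((Real.sqrt 2 : ℝ) : ℂ)⁻¹) = 1 / 2 := by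
    rw [← mul_inv, ← Complex.ofReal_mul, Real.mul_self_sqrt (by norm_num)]; norm_num
  rw [hadamard, smul_mul_assoc, smul_mul_smul_comm, h]
  ext i j
  fin_cases i <;> fin_cases j <;>
    simp [phaseGate] <;> ring

theorem phaseGate_pow_three : phaseGate ^ 3 = Matrix.diagonal ![1, -Complex.I] := by
  ext i j
  fin_cases i <;> fin_cases j <;> simp [phaseGate, pow_succ]

/-- A vertex complementation is a local Clifford operator; with these gates there is not even a
phase to correct. -/
theorem tensor_complOp_mulVec {n : ℕ} (G : SimpleGraph (Fin n)) (i : Fin n) :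
    tensor (complOp G i) *ᵥ graphState G = graphState (vertexCompl G i) := by
  classical
  ext x
  rw [tensor_mulVec_apply _ i, graphState_vertexCompl, graphState_update_rev]
  · have h1 : complOp G i i (x i) (x i) = (1 + Complex.I) / 2 := by
      rw [complOp, if_pos rfl, sqrtX_eq]
      generalize x i = b; fin_cases b <;> rfl
    have h2 : complOp G i i (x i) (x i).rev = (1 - Complex.I) / 2 := by
      rw [complOp, if_pos rfl, sqrtX_eq]
      generalize x i = b; fin_cases b <;> rfl
    have h3 : ∏ k ∈ Finset.univ.erase i, complOp G i k (x k) (x k) =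
        ∏ k, if G.Adj i k ∧ x k = 1 then -Complex.I else 1 := by
      rw [← Finset.mul_prod_erase Finset.univ
        (fun k => if G.Adj i k ∧ x k = 1 then -Complex.I else 1) (Finset.mem_univ i)]
      simp only [SimpleGraph.irrefl, false_and, if_false, one_mul]
      refine Finset.prod_congr rfl fun k hk => ?_
      rw [complOp, if_neg (Finset.ne_of_mem_erase hk), phaseGate_pow_three]
      by_cases h : G.Adj i k
      · generalize x k = b
        fin_cases b <;> simp [h]
      · simp [h]
    rw [h1, h2, h3]
    ring
  · intro k hk
    rw [complOp, if_neg hk, phaseGate_pow_three]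
    split_ifs
    · exact Matrix.isDiag_diagonal _
    · exact Matrix.isDiag_one

theorem lcEquiv_vertexCompl {n : ℕ} (G : SimpleGraph (Fin n)) (i : Fin n) :
    LCEquiv (graphState (vertexCompl G i)) (graphState G) :=
  ⟨complOp G i, complOp_mem G i, 1, by simp, by rw [tensor_complOp_mulVec, one_smul]⟩

/-! ### Pulling stabilizers back along a local operator -/

/-- The graph state `|G⟩` is a nonzero multiple of the image of `|H⟩` under an invertible local
operator whose factor at each qubit `k` conjugates `Z` to plus or minus the Pauli matrix of the
axis `t k`. -/
def AlignedBy {n : ℕ} (G H : SimpleGraph (Fin n)) (t : Fin n → Axis) : Prop :=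
  ∃ (U : Fin n → Matrix (Fin 2) (Fin 2) ℂ) (α : ℂ), α ≠ 0 ∧ (∀ k, IsUnit (U k)) ∧
    (∀ k, SendsPauli (U k) .z (t k)) ∧ graphState G = α • (tensor U *ᵥ graphState H)

theorem isUnit_of_mem_clifford {U : Matrix (Fin 2) (Fin 2) ℂ} (hU : U ∈ clifford) : IsUnit U := by
  obtain ⟨V, -, hV⟩ := exists_inverse_of_mem_clifford hU
  exact IsUnit.of_mul_eq_one_right V hV

theorem LCEquiv.exists_alignedBy {n : ℕ} {G H : SimpleGraph (Fin n)}
    (h : LCEquiv (graphState G) (graphState H)) : ∃ t, AlignedBy G H t := by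
  obtain ⟨U, hU, α, hα, h⟩ := h
  choose t ht using fun k => exists_sendsPauli_of_mem_clifford (hU k) .z
  exact ⟨t, U, α, by rintro rfl; simp at hα, fun k => isUnit_of_mem_clifford (hU k), ht, h⟩

open Classical in
/-- The action of a vertex complementation at `i` on the axes of the qubits: it exchanges `Y` and
`Z` at `i`, and `X` and `Y` at the neighbors of `i`. -/
def complAxis {n : ℕ} (G : SimpleGraph (Fin n)) (i : Fin n) (t : Fin n → Axis) (k : Fin n) : Axis :=
  if k = i then hadamardAxis (phaseAxis (hadamardAxis (t k)))
  else if G.Adj i k then phaseAxis (t k) else t k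

theorem sendsPauli_complOp {n : ℕ} (G : SimpleGraph (Fin n)) (i : Fin n) (t : Fin n → Axis)
    (k : Fin n) : SendsPauli (complOp G i k) (t k) (complAxis G i t k) := by
  unfold complOp complAxis
  split_ifs
  · exact ((sendsPauli_hadamard _).mul (sendsPauli_phaseGate _)).mul (sendsPauli_hadamard _)
  · have h := ((sendsPauli_phaseGate _).mul (sendsPauli_phaseGate _)).mul
      (sendsPauli_phaseGate (t k))
    rw [pow_succ, pow_two]
    cases hk : t k <;> rwa [hk] at h
  · exact ⟨1, by norm_num, by simp⟩

theorem AlignedBy.complement {n : ℕ} {G H : SimpleGraph (Fin n)} {t : Fin n → Axis}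
    (h : AlignedBy G H t) (i : Fin n) : AlignedBy (vertexCompl G i) H (complAxis G i t) := by
  obtain ⟨U, α, hα, hU, ht, h⟩ := h
  refine ⟨fun k => complOp G i k * U k, α, hα,
    fun k => (isUnit_of_mem_clifford (complOp_mem G i k)).mul (hU k),
    fun k => (sendsPauli_complOp G i t k).mul (ht k), ?_⟩
  rw [← tensor_complOp_mulVec, h, Matrix.mulVec_smul, Matrix.mulVec_mulVec, tensor_mul]

open Classical in
/-- The local operator with an arbitrary factor `W` at `i`, Pauli `Z` up to the scalars `s` at the
neighbors of `i`, and `1` elsewhere. For `W = X` and `s = 1` it is the stabilizer generator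
`X_i Z_{N(i)}` of the graph state. -/
def starOp {n : ℕ} (G : SimpleGraph (Fin n)) (i : Fin n) (W : Matrix (Fin 2) (Fin 2) ℂ)
    (s : Fin n → ℂ) (k : Fin n) : Matrix (Fin 2) (Fin 2) ℂ :=
  if k = i then W else if G.Adj i k then s k • pauli .z else 1

open Classical in
theorem tensor_starOp_mulVec_apply {n : ℕ} (G H : SimpleGraph (Fin n)) (i : Fin n)
    (W : Matrix (Fin 2) (Fin 2) ℂ) (s : Fin n → ℂ) (x : Fin n → Fin 2) :
    (tensor (starOp G i W s) *ᵥ graphState H) x =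
      (∏ k, if G.Adj i k then s k else 1) * nbrSign G i x *
        (W (x i) (x i) + W (x i) (x i).rev * nbrSign H i x) * graphState H x := by
  rw [tensor_mulVec_apply _ i, graphState_update_rev]
  · have h : ∏ k ∈ Finset.univ.erase i, starOp G i W s k (x k) (x k) =
        (∏ k, if G.Adj i k then s k else 1) * nbrSign G i x := by
      rw [nbrSign, ← Finset.prod_mul_distrib, ← Finset.mul_prod_erase Finset.univ _
        (Finset.mem_univ i)]
      simp only [SimpleGraph.irrefl, false_and, if_false, one_mul]
      refine Finset.prod_congr rfl fun k hk => ?_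
      rw [starOp, if_neg (Finset.ne_of_mem_erase hk)]
      by_cases h : G.Adj i k
      · generalize x k = b
        fin_cases b <;> simp [h, pauli]
      · simp [h]
    rw [h, starOp, if_pos rfl]
    ring
  · intro k hk
    rw [starOp, if_neg hk]
    split_ifs
    · intro a b hab
      fin_cases a <;> fin_cases b <;> simp [pauli] at hab ⊢
    · exact Matrix.isDiag_one

/-- The stabilizer equation `X_i Z_{N(i)} |G⟩ = |G⟩`. -/
theorem tensor_starOp_mulVec_self {n : ℕ} (G : SimpleGraph (Fin n)) (i : Fin n) :
    tensor (starOp G i (pauli .x) 1) *ᵥ graphState G = graphState G := by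
  classical
  ext x
  have h1 : pauli .x (x i) (x i) = 0 := by generalize x i = b; fin_cases b <;> rfl
  have h2 : pauli .x (x i) (x i).rev = 1 := by generalize x i = b; fin_cases b <;> rfl
  rw [tensor_starOp_mulVec_apply, h1, h2]
  simp only [Pi.one_apply, ite_self, Finset.prod_const_one]
  linear_combination graphState G x * nbrSign_mul_self G i x

/-- If all neighbors of `i` have the axis `Z`, then the pullback of the stabilizer `X_i Z_{N(i)}`
of `|G⟩` along the aligning operator is again a star-shaped operator, with some factor `W` at `i`.
It stabilizes `|H⟩`; this is the stabilizer equation, read off amplitude by amplitude. The factor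
`W` is diagonal if `i` has the axis `X`, and it has zero diagonal if `i` has the axis `Z`. -/
theorem AlignedBy.exists_stabilizer {n : ℕ} {G H : SimpleGraph (Fin n)} {t : Fin n → Axis}
    (h : AlignedBy G H t) (i : Fin n) (hi : ∀ k, G.Adj i k → t k = .z) :
    ∃ (W : Matrix (Fin 2) (Fin 2) ℂ) (s : ℂ),
      (∀ x : Fin n → Fin 2, s * nbrSign G i x *
        (W (x i) (x i) + W (x i) (x i).rev * nbrSign H i x) = 1) ∧
      (t i = .x → ∃ c : ℂ, W = c • pauli .z) ∧ (t i = .z → W 0 0 = 0) := by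
  classical
  obtain ⟨U, α, hα, hU, ht, h⟩ := h
  choose s hs ht using ht
  obtain ⟨V, hVU⟩ := (hU i).exists_left_inv
  have hUV : U i * V = 1 := mul_eq_one_comm.1 hVU
  have hcomm : ∀ k, starOp G i (pauli .x) 1 k * U k =
      U k * starOp G i (V * pauli .x * U i) s k := by
    intro k
    unfold starOp
    split_ifs with h1 h2
    · subst h1
      rw [← mul_assoc, ← mul_assoc, hUV, one_mul]
    · rw [mul_smul_comm, ht k, hi k h2, smul_smul, hs, Pi.one_apply, one_smul, one_smul]
    · simp
  have hinj : Function.Injective fun φ : QState n => tensor U *ᵥ φ := by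
    choose V' hV' using fun k => (hU k).exists_left_inv
    intro φ χ hφ
    have := congrArg (fun v => tensor V' *ᵥ v) hφ
    simpa [Matrix.mulVec_mulVec, tensor_mul, hV', tensor_one] using this
  have hstab : tensor (starOp G i (V * pauli .x * U i) s) *ᵥ graphState H = graphState H := by
    apply hinj
    have h' := tensor_starOp_mulVec_self G i
    rw [h, Matrix.mulVec_smul] at h'
    have h'' := smul_right_injective _ hα h'
    rw [Matrix.mulVec_mulVec, tensor_mul, funext hcomm, ← tensor_mul, ← Matrix.mulVec_mulVec] at h''
    exact h''
  refine ⟨V * pauli .x * U i, ∏ k, if G.Adj i k then s k else 1, fun x => ?_,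
    fun hx => ⟨s i, ?_⟩, fun hz => ?_⟩
  · have := congrFun hstab x
    rw [tensor_starOp_mulVec_apply] at this
    exact mul_right_cancel₀ (graphState_ne_zero H x) (this.trans (one_mul _).symm)
  · have h1 := ht i
    rw [hx] at h1
    have h2 : pauli .x * U i = s i • (U i * pauli .z) := by
      rw [h1, smul_smul, hs, one_smul]
    rw [mul_assoc, h2, mul_smul_comm, ← mul_assoc, hVU, one_mul]
  · -- `U i` and `Z` commute up to a sign, so `W` anticommutes with `Z`, as `X` does.
    have h1 := ht i
    rw [hz] at h1
    have h2 : pauli .z * U i = s i • (U i * pauli .z) := by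
      rw [h1, smul_smul, hs, one_smul]
    have h3 : V * pauli .z = s i • (pauli .z * V) := by
      calc V * pauli .z = V * (pauli .z * U i) * V := by rw [mul_assoc, mul_assoc, hUV, mul_one]
        _ = s i • (pauli .z * V) := by
          rw [h2, mul_smul_comm, smul_mul_assoc, ← mul_assoc, hVU, one_mul]
    have hxz : pauli .x * pauli .z = -(pauli .z * pauli .x) := by
      ext a b; fin_cases a <;> fin_cases b <;> simp [pauli]
    have h4 : V * pauli .x * U i * pauli .z = -(pauli .z * (V * pauli .x * U i)) := by
      calc V * pauli .x * U i * pauli .z = s i • (V * (pauli .x * pauli .z) * U i) := by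
            rw [mul_assoc, h1]; simp only [mul_smul_comm, mul_assoc]
        _ = -(s i • (V * pauli .z * pauli .x * U i)) := by
            rw [hxz]; simp only [mul_neg, neg_mul, smul_neg, mul_assoc]
        _ = _ := by
            rw [h3]; simp only [smul_mul_assoc, smul_smul, hs, one_smul, mul_assoc]
    have h5 := congrFun (congrFun h4 0) 0
    generalize V * pauli .x * U i = W at h5 ⊢
    rw [Matrix.neg_apply, Matrix.mul_apply, Matrix.mul_apply, Fin.sum_univ_two,
      Fin.sum_univ_two] at h5
    simp [pauli] at h5
    linear_combination h5 / 2

/-- A qubit with the axis `X` has a neighbor whose axis is not `Z`: otherwise a diagonal operator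
that is negated by a bit flip at that qubit would fix a vector without zero entries. -/
theorem AlignedBy.exists_adj {n : ℕ} {G H : SimpleGraph (Fin n)} {t : Fin n → Axis}
    (h : AlignedBy G H t) {i : Fin n} (hi : t i = .x) : ∃ j, G.Adj i j ∧ t j ≠ .z := by
  by_contra! hz
  obtain ⟨W, s, hW, hx, -⟩ := h.exists_stabilizer i hz
  obtain ⟨c, rfl⟩ := hx hi
  have h0 := hW (Function.update 0 i 0)
  have h1 := hW (Function.update 0 i 1)
  simp only [Function.update_self, nbrSign_update] at h0 h1
  simp [pauli] at h0 h1
  have : (1 : ℂ) = -1 := by linear_combination -h0 - h1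
  norm_num at this

theorem nbrSign_zero {n : ℕ} (G : SimpleGraph (Fin n)) (i : Fin n) : nbrSign G i 0 = 1 :=
  Finset.prod_eq_one fun k _ => by simp

open Classical in
theorem nbrSign_single {n : ℕ} (G : SimpleGraph (Fin n)) (i j : Fin n) :
    nbrSign G i (Pi.single j 1) = if G.Adj i j then -1 else 1 := by
  rw [nbrSign, Finset.prod_eq_single j]
  · simp
  · intro k _ hk; simp [Pi.single_eq_of_ne hk]
  · simp

/-- If all axes are `Z`, the graphs agree: the stabilizer equation of `exists_stabilizer` at the
basis states `0` and `e_j` compares the signs of `ij` in `G` and in `H`. -/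
theorem AlignedBy.eq {n : ℕ} {G H : SimpleGraph (Fin n)} {t : Fin n → Axis}
    (h : AlignedBy G H t) (ht : ∀ k, t k = .z) : G = H := by
  classical
  ext i j
  by_cases hij : i = j
  · subst hij; simp
  obtain ⟨W, s, hW, -, hz⟩ := h.exists_stabilizer i fun k _ => ht k
  have h0 := hW 0
  have h1 := hW (Pi.single j 1)
  rw [Pi.zero_apply, hz (ht i), nbrSign_zero, nbrSign_zero] at h0
  rw [Pi.single_eq_of_ne hij, hz (ht i), nbrSign_single, nbrSign_single] at h1
  have h2 : ((if G.Adj i j then -1 else 1) * if H.Adj i j then -1 else 1 : ℂ) = 1 := by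
    linear_combination h1 - ((if G.Adj i j then -1 else 1) * if H.Adj i j then -1 else 1 : ℂ) * h0
  by_cases hG : G.Adj i j <;> by_cases hH : H.Adj i j <;> simp [hG, hH] at h2 ⊢ <;> norm_num at h2

/-! ### Counting complementations -/

/-- The qubits whose axis is not `Z`. -/
def tilted {n : ℕ} (t : Fin n → Axis) : Finset (Fin n) := Finset.univ.filter fun k => t k ≠ .z

theorem complAxis_of_ne_eq_z_iff {n : ℕ} (G : SimpleGraph (Fin n)) {i k : Fin n} (t : Fin n → Axis)
    (hk : k ≠ i) : complAxis G i t k = .z ↔ t k = .z := by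
  unfold complAxis
  rw [if_neg hk]
  split_ifs
  · cases t k <;> simp [phaseAxis]
  · rfl

theorem card_tilted_complAxis_of_y {n : ℕ} (G : SimpleGraph (Fin n)) {i : Fin n} {t : Fin n → Axis}
    (hi : t i = .y) : (tilted (complAxis G i t)).card + 1 = (tilted t).card := by
  have : tilted (complAxis G i t) = (tilted t).erase i := by
    ext k
    by_cases hk : k = i
    · subst hk
      simp only [tilted, Finset.mem_filter]
      simp [complAxis, hi, hadamardAxis, phaseAxis]
    · simp [tilted, complAxis_of_ne_eq_z_iff G t hk, hk]
  rw [this]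
  exact Finset.card_erase_add_one (by simp [tilted, hi])

theorem card_tilted_complAxis_of_x {n : ℕ} (G : SimpleGraph (Fin n)) {i : Fin n} {t : Fin n → Axis}
    (hi : t i = .x) : (tilted (complAxis G i t)).card = (tilted t).card := by
  congr 1
  ext k
  by_cases hk : k = i
  · subst hk
    simp only [tilted, Finset.mem_filter]
    simp [complAxis, hi, hadamardAxis, phaseAxis]
  · simp [tilted, complAxis_of_ne_eq_z_iff G t hk]

/-- Aligned graph states are related by at most three complementations for every two tilted
qubits. A tilted qubit with axis `Y` is straightened by one complementation. If there is none, then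
a tilted qubit `i` has a tilted neighbor `j`, both have the axis `X`, and complementing at `i`, `j`
and `i` straightens both. -/
theorem AlignedBy.exists_list {n : ℕ} {G H : SimpleGraph (Fin n)} {t : Fin n → Axis}
    (h : AlignedBy G H t) :
    ∃ l : List (Fin n), 2 * l.length ≤ 3 * (tilted t).card ∧ l.foldl vertexCompl G = H := by
  induction hm : (tilted t).card using Nat.strong_induction_on generalizing G t with
  | _ m ih =>
  by_cases hy : ∃ i, t i = .y
  · obtain ⟨i, hi⟩ := hy
    have hc := card_tilted_complAxis_of_y G hi
    obtain ⟨l, hl, hlH⟩ := ih _ (by omega) (h.complement i) rfl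
    exact ⟨i :: l, by simp only [List.length_cons]; omega, hlH⟩
  by_cases hz : ∀ k, t k = .z
  · exact ⟨[], by simp, h.eq hz⟩
  push Not at hy hz
  have hx : ∀ k, t k ≠ .z → t k = .x := fun k hk => by
    have := hy k
    cases hk' : t k <;> simp_all
  obtain ⟨i, hi⟩ := hz
  replace hi := hx i hi
  obtain ⟨j, hij, hj⟩ := h.exists_adj hi
  replace hj := hx j hj
  have hji : (vertexCompl G i).Adj j i := by
    have : j ∈ (vertexCompl G i).neighborSet i := by
      rw [neighborSet_vertexCompl]; exact hij
    exact SimpleGraph.Adj.symm this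
  have h1 : complAxis G i t i = .x := by simp [complAxis, hi, hadamardAxis, phaseAxis]
  have h2 : complAxis G i t j = .y := by simp [complAxis, hij, hij.ne', hj, phaseAxis]
  have h3 : complAxis (vertexCompl G i) j (complAxis G i t) i = .y := by
    rw [complAxis, if_neg hij.ne, if_pos hji, h1, phaseAxis]
  have c1 := card_tilted_complAxis_of_x G hi
  have c2 := card_tilted_complAxis_of_y (vertexCompl G i) h2
  have c3 := card_tilted_complAxis_of_y
    (vertexCompl (vertexCompl G i) j) h3
  obtain ⟨l, hl, hlH⟩ := ih _ (by omega) (((h.complement i).complement j).complement i) rfl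
  exact ⟨i :: j :: i :: l, by simp only [List.length_cons]; omega, hlH⟩

/-- Successive complementations form a walk in the orbit. A complementation may fix the isomorphism
class, which shortens the walk. -/
theorem edist_foldl_vertexCompl_le {n : ℕ} (G₀ : SimpleGraph (Fin n)) (l : List (Fin n))
    (G : SimpleGraph (Fin n)) (hG : LCEquiv (graphState G₀) (graphState G))
    (hH : unlabel (l.foldl vertexCompl G) ∈ lcOrbit G₀) :
    (orbitGraph G₀).edist ⟨unlabel G, G, rfl, hG⟩ ⟨unlabel (l.foldl vertexCompl G), hH⟩ ≤
      l.length := by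
  induction l generalizing G with
  | nil => simp
  | cons i l ih =>
    have hG' := hG.trans (lcEquiv_vertexCompl G i).symm
    refine (SimpleGraph.edist_triangle (v := ⟨unlabel (vertexCompl G i), _, rfl, hG'⟩)).trans ?_
    rw [List.length_cons, Nat.cast_succ, add_comm]
    refine add_le_add (ih _ hG' hH) ?_
    by_cases h : unlabel G = unlabel (vertexCompl G i)
    · rw [show (⟨unlabel G, G, rfl, hG⟩ : lcOrbit G₀) =
        ⟨unlabel (vertexCompl G i), _, rfl, hG'⟩ from Subtype.ext h]
      simp
    · refine (SimpleGraph.edist_eq_one_iff_adj.2 ?_).le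
      exact ⟨h, G, i, rfl, rfl⟩

end GraphState

end

theorem theorem7p2 (n : ℕ) (G : SimpleGraph (Fin n)) :
    (GraphState.orbitGraph G).ediam ≤ ((3 * n / 2 : ℕ) : ℕ∞) := by
  rw [SimpleGraph.ediam_le_iff]
  rintro ⟨_, H, rfl, hH⟩ ⟨_, K, rfl, hK⟩
  obtain ⟨t, ht⟩ := (hH.symm.trans hK).exists_alignedBy
  obtain ⟨l, hl, rfl⟩ := ht.exists_list
  refine (GraphState.edist_foldl_vertexCompl_le G l H hH _).trans ?_
  have : (GraphState.tilted t).card ≤ n := by simpa using Finset.card_le_univ (GraphState.tilted t)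
  exact_mod_cast (by omega : l.length ≤ 3 * n / 2)
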